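/- **Corollary 8.2 (Bieri–Strebel splitting theorem).** All locally compact groups are assumed Hausdorff. A locally compact group $G$ is *compactly presented* if there are a set $S$, a set $R$ of elements of bounded word length in the free group $F_S$, and a group isomorphism from $\langle S\mid R\rangle$ onto $G$ such that the image of $S$ is a compact subset of $G$. A topological group is *compactly generated* if it is generated, as a group, by a compact subset. Given a locally compact group $H$, open subgroups $K, L$ of $H$ and an isomorphism of topological groups $\varphi\colon K\to L$, the HNN-extension $$\mathrm{HNN}(H,K,L,\varphi)=\langle H, t \mid t k t^{-1}=\varphi(k)\ \ \forall k\in K\rangle$$ carries the unique topology making it a topological group in which $H$ is an open subgroup. A locally compact group $G$ *splits as an HNN-extension over* an open subgroup $H$ of $G$ if there are such $K, L,\varphi$ for which $(G,H)$ and $(\mathrm{HNN}(H,K,L,\varphi),H)$ are isomorphic as pairs of topological groups. Let $G$ be a compactly presented locally compact group and let $\pi\colon G\to\mathbf{Z}$ be a continuous surjective homomorphism. Then there is a compactly generated open subgroup $H$ of $G$ with $H\subseteq\ker\pi$ such that $G$ splits as an HNN-extension over $H$. -/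

import Mathlib

/-- A topological group is compactly generated if it is generated, as a group, by some compact
subset. -/
def CompactlyGeneratedGroup (G : Type*) [Group G] [TopologicalSpace G] : Prop :=
  ∃ C : Set G, IsCompact C ∧ Subgroup.closure C = ⊤

open Classical in
/-- A set `R` of elements of the free group on `S` has bounded length: there is a bound on the
word length of its elements with respect to `S`. -/
def BoundedRelators {S : Type*} (R : Set (FreeGroup S)) : Prop :=
  ∃ n : ℕ, ∀ r ∈ R, FreeGroup.norm r ≤ n

/-- A topological group `G` is compactly presented if there is an (abstract) group isomorphism of
a group `⟨S | R⟩`, with `R` a set of words of bounded length in `S`, onto `G`, such that the image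
of `S` in `G` is compact. This image automatically generates `G`. Since `S` can always be replaced
by its image in `G`, nothing is lost in taking `S` in the universe of `G`. -/
def CompactlyPresentedGroup.{u} (G : Type u) [Group G] [TopologicalSpace G] : Prop :=
  ∃ (S : Type u) (R : Set (FreeGroup S)), BoundedRelators R ∧
    ∃ e : PresentedGroup R ≃* G,
      IsCompact (Set.range fun s : S => e (PresentedGroup.of s))

/-- `τ` is a group topology on `HNN(H, K, L, φ) = ⟨H, t | t k t⁻¹ = φ(k) ∀ k ∈ K⟩` for which the
canonical map identifies `H`, as a topological group, with an open subgroup. -/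
structure IsHNNTopology {H : Type*} [Group H] [TopologicalSpace H] {K L : Subgroup H}
    {φ : K ≃* L} (τ : TopologicalSpace (HNNExtension H K L φ)) : Prop where
  isTopologicalGroup : @IsTopologicalGroup (HNNExtension H K L φ) τ _
  isOpenEmbedding : @Topology.IsOpenEmbedding H (HNNExtension H K L φ) _ τ HNNExtension.of

/-- There is at most one such topology, so one may speak of *the* topology of an
HNN-extension. -/
theorem IsHNNTopology.unique {H : Type*} [Group H] [TopologicalSpace H] {K L : Subgroup H}
    {φ : K ≃* L} {τ τ' : TopologicalSpace (HNNExtension H K L φ)}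
    (h : IsHNNTopology τ) (h' : IsHNNTopology τ') : τ = τ' := by
  refine IsTopologicalGroup.ext h.isTopologicalGroup h'.isTopologicalGroup ?_
  have h1 := @Topology.IsOpenEmbedding.map_nhds_eq _ _ _ _ τ h.isOpenEmbedding 1
  have h2 := @Topology.IsOpenEmbedding.map_nhds_eq _ _ _ _ τ' h'.isOpenEmbedding 1
  rw [map_one] at h1 h2
  exact h1.symm.trans h2

/-- `G` splits as an HNN-extension over its open subgroup `H`: there are open subgroups `K`, `L`
of `H` and an isomorphism of topological groups `φ : K → L` such that the pair `(G, H)` is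
isomorphic, as a pair of topological groups, to `(HNN(H, K, L, φ), H)`, where the HNN-extension
carries its topology (the group topology in which `H` is an open subgroup). -/
def SplitsAsHNNOver {G : Type*} [Group G] [TopologicalSpace G] (H : Subgroup G) : Prop :=
  IsOpen (H : Set G) ∧
    ∃ (K L : Subgroup H) (φ : K ≃ₜ* L), IsOpen (K : Set H) ∧ IsOpen (L : Set H) ∧
      ∃ τ : TopologicalSpace (HNNExtension H K L φ.toMulEquiv), IsHNNTopology τ ∧
        ∃ e : HNNExtension H K L φ.toMulEquiv ≃ₜ* G, ∀ h : H, e (HNNExtension.of h) = (h : G)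

/-!
Choose `t` with `π t = 1` and write each generator `s` of the compact presentation as
`t ^ π(s) * a(s)`, so that the elements `a(s)` form a compact subset of `ker π`. For a large bound
`M` let `H` be the subgroup generated by the compact set of all conjugates `tⁱ a(s) t⁻ⁱ` with
`|i| ≤ M`, and compare `G` with the HNN-extension of `H` whose stable letter acts as conjugation
by `t` from `H ∩ t⁻¹ H t` onto `H ∩ t H t⁻¹` (`ConjHNN`).

The key point is `ConjHNN.lift_mk_eq`: a word in the generators of length at most `M / max |π(s)|`
can be rewritten as `h * t ^ p` with `h ∈ H`, moving powers of `t` to the right, and every step of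
the rewriting is already valid in the HNN-extension, since only conjugates by `tⁱ` with `|i| ≤ M`
occur. If the word represents `1` in `G`, applying `π` gives `p = 0`, hence `h = 1`, and the word
is trivial in the HNN-extension as well. The relators have bounded length, hence for `M` large the
map `s ↦ t ^ π(s) * a(s)`, with `t` replaced by the stable letter, defines a homomorphism from `G`
to the HNN-extension, which is inverse to the canonical map in the other direction.

The same normal form shows that `H` is open: by the Baire category theorem
(`IsCompact.exists_pow_mem_nhds_one`) the words of some bounded length fill a neighbourhood of the
identity in `G`, and those among them that lie in `ker π` belong to `H`. Thus the topology of `G`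
transports to the HNN-extension (`ConjHNN.splitsAsHNNOver`).
-/

open scoped Pointwise Topology

/-! ### Groups generated by a compact subset -/

/-- By the Baire category theorem, in a locally compact group generated by a symmetric compact set,
some power of this set is a neighbourhood of the identity. -/
theorem IsCompact.exists_pow_mem_nhds_one {G : Type*} [Group G] [TopologicalSpace G]
    [IsTopologicalGroup G] [T2Space G] [BaireSpace G] {C : Set G} (hC : IsCompact C)
    (hinv : C⁻¹ = C) (hgen : Subgroup.closure C = ⊤) : ∃ n : ℕ, C ^ n ∈ 𝓝 (1 : G) := by
  have hcompact : ∀ n : ℕ, IsCompact (C ^ n) := by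
    intro n
    induction n with
    | zero => simp
    | succ n ih => rw [pow_succ]; exact ih.mul hC
  have hsymm : ∀ n : ℕ, (C ^ n)⁻¹ = C ^ n := fun n => by rw [← inv_pow, hinv]
  have hcover : ⋃ n : ℕ, C ^ n = Set.univ := by
    refine Set.eq_univ_of_forall fun g => Set.mem_iUnion.2 ?_
    have hg : g ∈ Subgroup.closure C := hgen ▸ Subgroup.mem_top g
    induction hg using Subgroup.closure_induction with
    | mem x hx => exact ⟨1, by simpa using hx⟩
    | one => exact ⟨0, by simp⟩
    | mul x y _ _ hx hy =>
      obtain ⟨m, hm⟩ := hx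
      obtain ⟨n, hn⟩ := hy
      exact ⟨m + n, pow_add C m n ▸ Set.mul_mem_mul hm hn⟩
    | inv x _ hx =>
      obtain ⟨n, hn⟩ := hx
      exact ⟨n, hsymm n ▸ Set.inv_mem_inv.2 hn⟩
  obtain ⟨n, g, hg⟩ :=
    nonempty_interior_of_iUnion_of_closed (fun n => (hcompact n).isClosed) hcover
  refine ⟨n + n, ?_⟩
  have hnhds : g⁻¹ • C ^ n ∈ 𝓝 (1 : G) := by
    simpa using smul_mem_nhds_smul g⁻¹ (mem_interior_iff_mem_nhds.1 hg)
  refine Filter.mem_of_superset hnhds ?_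
  rintro _ ⟨x, hx, rfl⟩
  rw [pow_add]
  exact Set.mul_mem_mul (hsymm n ▸ Set.inv_mem_inv.2 (interior_subset hg)) hx

theorem FreeGroup.exists_length_le_of_mem_pow {S G : Type*} [Group G] (q : FreeGroup S →* G)
    {n : ℕ} {g : G}
    (hg : g ∈ (Set.range (fun s => q (.of s)) ∪ (Set.range fun s => q (.of s))⁻¹) ^ n) :
    ∃ w : List (S × Bool), w.length ≤ n ∧ q (FreeGroup.mk w) = g := by
  induction n generalizing g with
  | zero => exact ⟨[], le_rfl, by simpa [← FreeGroup.one_eq_mk, eq_comm] using hg⟩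
  | succ n ih =>
    rw [pow_succ] at hg
    obtain ⟨x, hx, y, hy, rfl⟩ := hg
    obtain ⟨w, hw, rfl⟩ := ih hx
    rcases hy with ⟨s, rfl⟩ | ⟨s, hs⟩
    · exact ⟨w ++ [(s, true)], by simpa using hw, by rw [← FreeGroup.mul_mk, q.map_mul]; rfl⟩
    · refine ⟨w ++ [(s, false)], by simpa using hw, ?_⟩
      rw [← FreeGroup.mul_mk, q.map_mul, ← inv_inv y, ← hs, ← q.map_inv]
      rfl

/-! ### The HNN-extension of a subgroup by a conjugation -/

/-- The subgroup `H ∩ t⁻¹ H t` of `H`. -/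
def conjDomain {G : Type*} [Group G] (H : Subgroup G) (t : G) : Subgroup H :=
  (H.comap (MulAut.conj t).toMonoidHom).subgroupOf H

theorem mem_conjDomain {G : Type*} [Group G] {H : Subgroup G} {t : G} {h : H} :
    h ∈ conjDomain H t ↔ t * h * t⁻¹ ∈ H := by
  simp [conjDomain, Subgroup.mem_subgroupOf]

/-- Conjugation by `t`, as an isomorphism from `H ∩ t⁻¹ H t` onto `H ∩ t H t⁻¹`. -/
def conjEquiv {G : Type*} [Group G] (H : Subgroup G) (t : G) :
    conjDomain H t ≃* conjDomain H t⁻¹ where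
  toFun h := ⟨⟨t * h * t⁻¹, mem_conjDomain.1 h.2⟩, by
    rw [mem_conjDomain]; simp [mul_assoc]⟩
  invFun h := ⟨⟨t⁻¹ * h * t, by simpa using mem_conjDomain.1 h.2⟩, by
    rw [mem_conjDomain]; simp [mul_assoc]⟩
  left_inv h := by ext; simp [mul_assoc]
  right_inv h := by ext; simp [mul_assoc]
  map_mul' g h := by ext; simp [mul_assoc]

theorem coe_conjEquiv {G : Type*} [Group G] (H : Subgroup G) (t : G) (h : conjDomain H t) :
    ((conjEquiv H t h : H) : G) = t * h * t⁻¹ := rfl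

section ConjHNN

variable {G : Type*} [Group G]

/-- The HNN-extension of `H` whose stable letter acts on `H ∩ t⁻¹ H t` as conjugation by `t`. -/
abbrev ConjHNN (H : Subgroup G) (t : G) : Type _ :=
  HNNExtension H (conjDomain H t) (conjDomain H t⁻¹) (conjEquiv H t)

/-- The homomorphism to `G` that is the inclusion on `H` and maps the stable letter to `t`. -/
def ConjHNN.toAmbient (H : Subgroup G) (t : G) : ConjHNN H t →* G :=
  HNNExtension.lift H.subtype t fun h => by simp [coe_conjEquiv]

@[simp]
theorem ConjHNN.toAmbient_of (H : Subgroup G) (t : G) (h : H) :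
    toAmbient H t (HNNExtension.of h) = h :=
  HNNExtension.lift_of _ _ _ h

@[simp]
theorem ConjHNN.toAmbient_t (H : Subgroup G) (t : G) :
    toAmbient H t HNNExtension.t = t :=
  HNNExtension.lift_t _ _ _

theorem ConjHNN.splitsAsHNNOver [TopologicalSpace G] [IsTopologicalGroup G] {H : Subgroup G} {t : G}
    (hH : IsOpen (H : Set G)) (hbij : Function.Bijective (toAmbient H t)) : SplitsAsHNNOver H := by
  have hopen : ∀ s : G, IsOpen (conjDomain H s : Set H) := by
    intro s
    have : (conjDomain H s : Set H) = (fun h : H => s * h * s⁻¹) ⁻¹' H := by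
      ext h; exact mem_conjDomain
    rw [this]
    exact hH.preimage (by fun_prop)
  let φ : conjDomain H t ≃ₜ* conjDomain H t⁻¹ :=
    { conjEquiv H t with
      continuous_toFun := by
        refine Continuous.subtype_mk (Continuous.subtype_mk ?_ _) _
        fun_prop
      continuous_invFun := by
        refine Continuous.subtype_mk (Continuous.subtype_mk ?_ _) _
        fun_prop }
  let e := MulEquiv.ofBijective (toAmbient H t) hbij
  let τ : TopologicalSpace (ConjHNN H t) := .induced e inferInstance
  have he : Topology.IsInducing e := ⟨rfl⟩
  have hhomeo : IsHomeomorph e := by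
    rw [isHomeomorph_iff_isEmbedding_surjective]
    exact ⟨⟨he, e.injective⟩, e.surjective⟩
  have hof : e ∘ HNNExtension.of = (Subtype.val : H → G) := funext fun h => toAmbient_of H t h
  refine ⟨hH, conjDomain H t, conjDomain H t⁻¹, φ, hopen t, hopen t⁻¹, τ,
    ⟨topologicalGroup_induced e, ?_⟩,
    { e with
      continuous_toFun := hhomeo.continuous
      continuous_invFun := (hhomeo.homeomorph _).continuous_symm }, toAmbient_of H t⟩
  · refine Topology.IsOpenEmbedding.of_comp _ hhomeo.isOpenEmbedding ?_
    rw [hof]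
    exact hH.isOpenEmbedding_subtypeVal

theorem ConjHNN.t_mul_of_mul_inv {H : Subgroup G} {t : G} {h h' : H}
    (hh : t * h * t⁻¹ = h') :
    (HNNExtension.t : ConjHNN H t) * HNNExtension.of h * HNNExtension.t⁻¹ =
      HNNExtension.of h' := by
  have := HNNExtension.equiv_eq_conj (φ := conjEquiv H t)
    ⟨h, mem_conjDomain.2 (hh ▸ h'.2)⟩
  rw [← this]
  congr 1
  exact Subtype.ext hh

/-- If all the conjugates `tⁱ x t⁻ⁱ` with `|i| ≤ M` lie in `H`, then the relation between the
stable letter and `H` can be applied step by step to compute the corresponding conjugates of `x`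
in the HNN-extension. -/
theorem ConjHNN.zpow_conj {H : Subgroup G} {t x : G} {M : ℕ}
    (hx : ∀ i : ℤ, |i| ≤ M → t ^ i * x * t ^ (-i) ∈ H) (hx0 : x ∈ H) (i : ℤ) (hi : |i| ≤ M) :
    (HNNExtension.t : ConjHNN H t) ^ i * HNNExtension.of ⟨x, hx0⟩ * HNNExtension.t ^ (-i) =
      HNNExtension.of ⟨t ^ i * x * t ^ (-i), hx i hi⟩ := by
  induction i using Int.induction_on with
  | zero => simp
  | succ n ih =>
    have hn : |(n : ℤ)| ≤ M := by rw [abs_le] at hi ⊢; omega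
    rw [← t_mul_of_mul_inv (h := ⟨_, hx n hn⟩) (h' := ⟨_, hx _ hi⟩) (by simp only; group),
      ← ih hn]
    group
  | pred n ih =>
    have hn : |(-n : ℤ)| ≤ M := by rw [abs_le] at hi ⊢; omega
    have key := t_mul_of_mul_inv (t := t) (h := ⟨_, hx _ hi⟩) (h' := ⟨_, hx _ hn⟩)
      (by simp only; group)
    rw [← ih hn] at key
    rw [← mul_left_inj (HNNExtension.t⁻¹), ← mul_right_inj HNNExtension.t, ← mul_assoc _ _ (_⁻¹),
      ← mul_assoc _ _ (_⁻¹), key]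
    group

/-- Normal form of short words. Let `d s` be integers with `|d s| ≤ m` and `a s` elements of `G`
whose conjugates `tⁱ a(s) t⁻ⁱ` with `|i| ≤ M` lie in `H`. A word in the letters `t ^ d s * a s` and
their inverses is of the form `h * t ^ p` with `h ∈ H`, and the same identity holds in the
HNN-extension, provided that (length of the word) `* m ≤ M`: this keeps the exponent of `t` in every
prefix within `[-M, M]`, so that moving it past the next letter only uses conjugates in `H`. -/
theorem ConjHNN.lift_mk_eq {S : Type*} {H : Subgroup G} {t : G} {a : S → G} {d : S → ℤ}
    {m M : ℕ} (hd : ∀ s, |d s| ≤ m) (ha : ∀ s (i : ℤ), |i| ≤ M → t ^ i * a s * t ^ (-i) ∈ H)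
    (ha0 : ∀ s, a s ∈ H) (w : List (S × Bool)) (hw : w.length * m ≤ M) :
    ∃ (h : H) (p : ℤ), |p| ≤ w.length * m ∧
      FreeGroup.lift (fun s => t ^ d s * a s) (FreeGroup.mk w) = h * t ^ p ∧
      FreeGroup.lift (fun s => (HNNExtension.t : ConjHNN H t) ^ d s *
        HNNExtension.of ⟨a s, ha0 s⟩) (FreeGroup.mk w) =
          HNNExtension.of h * HNNExtension.t ^ p := by
  induction w using List.reverseRecOn with
  | nil => exact ⟨1, 0, by simp, by simp [← FreeGroup.one_eq_mk], by simp [← FreeGroup.one_eq_mk]⟩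
  | append_singleton w l ih =>
    rw [List.length_append, List.length_singleton, add_mul, one_mul] at hw
    obtain ⟨h, p, hp, hq, hF⟩ := ih (by omega)
    obtain ⟨s, b⟩ := l
    have hM : ((w.length * m + m : ℕ) : ℤ) ≤ M := Int.ofNat_le.2 hw
    push_cast at hM
    have hds := abs_le.1 (hd s)
    rw [abs_le] at hp
    simp only [← FreeGroup.mul_mk, map_mul, hq, hF]
    cases b
    · have hpM : |p| ≤ (M : ℤ) := by rw [abs_le]; omega
      refine ⟨h * ⟨_, ha s p hpM⟩⁻¹, p - d s, ?_, ?_, ?_⟩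
      · push_cast [List.length_append, List.length_singleton, add_mul, one_mul]
        rw [abs_le]; omega
      · simp; group
      · rw [map_mul, map_inv, ← zpow_conj (fun i => ha s i) (ha0 s) p hpM]
        simp; group
    · have hpM : |p + d s| ≤ (M : ℤ) := by rw [abs_le]; omega
      refine ⟨h * ⟨_, ha s _ hpM⟩, p + d s, ?_, ?_, ?_⟩
      · push_cast [List.length_append, List.length_singleton, add_mul, one_mul]
        rw [abs_le]; omega
      · simp; group
      · rw [map_mul, ← zpow_conj (fun i => ha s i) (ha0 s) _ hpM]
        simp; group

end ConjHNN

/-! ### The splitting -/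

theorem corollary8p2 {G : Type*} [Group G] [TopologicalSpace G] [IsTopologicalGroup G]
    [T2Space G] [LocallyCompactSpace G] (hG : CompactlyPresentedGroup G)
    (π : G →* Multiplicative ℤ) (hπ : Continuous π) (hπ_surj : Function.Surjective π) :
    ∃ H : Subgroup G, H ≤ π.ker ∧ CompactlyGeneratedGroup H ∧ SplitsAsHNNOver H := by
  classical
  obtain ⟨S, R, ⟨nR, hR⟩, e, hC⟩ := hG
  let q : FreeGroup S →* G := e.toMonoidHom.comp (PresentedGroup.mk R)
  have hq_surj : Function.Surjective q := e.surjective.comp (QuotientGroup.mk'_surjective _)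
  change IsCompact (Set.range fun s : S => q (.of s)) at hC
  obtain ⟨t, ht⟩ := hπ_surj (.ofAdd 1)
  let d : S → ℤ := fun s => (π (q (.of s))).toAdd
  let a : S → G := fun s => t ^ (-d s) * q (.of s)
  have hπd : Continuous fun g => (π g).toAdd := continuous_toAdd.comp hπ
  obtain ⟨m, hd⟩ : ∃ m : ℕ, ∀ s, |d s| ≤ m := by
    obtain ⟨c, hc⟩ := hC.exists_bound_of_continuousOn hπd.continuousOn
    refine ⟨⌈c⌉₊, fun s => ?_⟩
    have := (hc _ ⟨s, rfl⟩).trans (Nat.le_ceil c)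
    rw [Int.norm_eq_abs] at this
    exact_mod_cast this
  have ha_compact : IsCompact (Set.range a) := by
    have hcont : Continuous fun g => t ^ (-(π g).toAdd) * g :=
      ((continuous_of_discreteTopology (f := fun i : ℤ => t ^ i)).comp hπd.neg).mul continuous_id
    have := hC.image hcont
    rwa [← Set.range_comp] at this
  have hq : q = FreeGroup.lift fun s => t ^ d s * a s := by
    ext s
    simp [a]
  obtain ⟨n₀, hn₀⟩ : ∃ n : ℕ, (Set.range (fun s => q (.of s)) ∪
      (Set.range fun s => q (.of s))⁻¹) ^ n ∈ 𝓝 (1 : G) := by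
    refine (hC.union hC.inv).exists_pow_mem_nhds_one (by simp [Set.union_comm]) ?_
    have hgen : Subgroup.closure (Set.range fun s => q (.of s)) = ⊤ := by
      have := q.map_closure (Set.range FreeGroup.of)
      rw [FreeGroup.closure_range_of, ← Set.range_comp, ← MonoidHom.range_eq_map,
        MonoidHom.range_eq_top.2 hq_surj] at this
      exact this.symm
    exact top_le_iff.1 (hgen ▸ Subgroup.closure_mono Set.subset_union_left)
  obtain ⟨wt, hwt⟩ := hq_surj t
  -- `N` bounds the lengths of the relators, of a word for `t`, and of words for the elements of a
  -- neighbourhood of the identity, so exponents of `t` stay bounded by `N * m` in these words.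
  let N : ℕ := max nR (max n₀ wt.toWord.length)
  let M : ℕ := N * m
  let C : Set G := ⋃ i ∈ Set.Icc (-M : ℤ) M, (fun x => t ^ i * x * t ^ (-i)) '' Set.range a
  have hC_compact : IsCompact C :=
    (Set.finite_Icc _ _).isCompact_biUnion fun i _ => ha_compact.image (by fun_prop)
  let H : Subgroup G := Subgroup.closure C
  have ha : ∀ s (i : ℤ), |i| ≤ M → t ^ i * a s * t ^ (-i) ∈ H := fun s i hi =>
    Subgroup.subset_closure (Set.mem_biUnion (abs_le.1 hi) ⟨a s, ⟨s, rfl⟩, rfl⟩)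
  have ha0 : ∀ s, a s ∈ H := fun s => by simpa using ha s 0 (by simp)
  have hHker : H ≤ π.ker := by
    refine (Subgroup.closure_le _).2 (Set.iUnion₂_subset fun i _ => ?_)
    rintro _ ⟨_, ⟨s, rfl⟩, rfl⟩
    have : π (a s) = 1 := by
      apply Multiplicative.toAdd.injective
      simp [a, ht, d]
    simp [this]
  let F : FreeGroup S →* ConjHNN H t :=
    FreeGroup.lift fun s => HNNExtension.t ^ d s * HNNExtension.of ⟨a s, ha0 s⟩
  have hword : ∀ w : List (S × Bool), w.length ≤ N → ∃ h : H,
      q (.mk w) = h * t ^ (π (q (.mk w))).toAdd ∧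
      F (.mk w) = HNNExtension.of h * HNNExtension.t ^ (π (q (.mk w))).toAdd := by
    intro w hw
    obtain ⟨h, p, -, h1, h2⟩ :=
      ConjHNN.lift_mk_eq hd ha ha0 w (Nat.mul_le_mul_right m hw)
    rw [← hq] at h1
    have hp : (π (q (.mk w))).toAdd = p := by
      have hh : π h = 1 := hHker h.2
      simp [h1, ht, hh]
    exact ⟨h, by rw [hp, ← h1], by rw [hp]; exact h2⟩
  have hHopen : IsOpen (H : Set G) := by
    have hker : (π.ker : Set G) ∈ 𝓝 (1 : G) :=
      ((isOpen_discrete {1}).preimage hπ).mem_nhds (map_one π)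
    refine H.isOpen_of_mem_nhds (g := 1) (Filter.mem_of_superset (Filter.inter_mem hn₀ hker) ?_)
    rintro g ⟨hg, hgker⟩
    obtain ⟨w, hw, rfl⟩ := FreeGroup.exists_length_le_of_mem_pow q hg
    obtain ⟨h, hh, -⟩ := hword w (by omega)
    rw [show π (q (.mk w)) = 1 from hgker] at hh
    rw [hh]
    simp
  have hF_rel : ∀ r ∈ R, F r = 1 := by
    intro r hr
    have hqr : q r = 1 := by
      change e (PresentedGroup.mk R r) = 1
      rw [PresentedGroup.one_of_mem hr, map_one]
    obtain ⟨h, hh, hFr⟩ := hword r.toWord ((hR r hr).trans (by omega))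
    rw [FreeGroup.mk_toWord, hqr, map_one, toAdd_one, zpow_zero, mul_one] at hh hFr
    rw [hFr, show h = 1 from Subtype.ext hh.symm, map_one]
  let ψ : G →* ConjHNN H t := (PresentedGroup.toGroup hF_rel).comp e.symm.toMonoidHom
  have hψq : ∀ w, ψ (q w) = F w := by
    intro w
    change PresentedGroup.toGroup hF_rel (e.symm (e (PresentedGroup.mk R w))) = F w
    rw [e.symm_apply_apply]
    rfl
  have hψt : ψ t = HNNExtension.t := by
    obtain ⟨h, hh, hFt⟩ := hword wt.toWord (by omega)
    rw [FreeGroup.mk_toWord, hwt, ht, toAdd_ofAdd, zpow_one] at hh hFt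
    have hψwt := hψq wt
    rw [hwt] at hψwt
    rw [hψwt, hFt, show h = 1 from Subtype.ext (right_eq_mul.1 hh), map_one, one_mul]
  have hψa : ∀ s, ψ (a s) = HNNExtension.of ⟨a s, ha0 s⟩ := by
    intro s
    rw [map_mul, map_zpow, hψt, hψq]
    simp [F]
  have hψH : ∀ x (hx : x ∈ H), ψ x = HNNExtension.of ⟨x, hx⟩ := by
    intro x hx
    induction hx using Subgroup.closure_induction with
    | mem x hx =>
      obtain ⟨i, hi, _, ⟨s, rfl⟩, rfl⟩ := Set.mem_iUnion₂.1 hx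
      simp only [map_mul, map_zpow, hψt, hψa]
      exact ConjHNN.zpow_conj (ha s) (ha0 s) i (abs_le.2 hi)
    | one => exact (map_one ψ).trans (map_one _).symm
    | mul x y hx hy ihx ihy => rw [map_mul, ihx, ihy, ← map_mul]; rfl
    | inv x hx ih => rw [map_inv, ih, ← map_inv]; rfl
  refine ⟨H, hHker, ⟨Subtype.val ⁻¹' C, ?_, Subgroup.closure_closure_coe_preimage⟩,
    ConjHNN.splitsAsHNNOver (t := t) hHopen ⟨?_, ?_⟩⟩
  · refine Topology.IsInducing.subtypeVal.isCompact_preimage' hC_compact ?_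
    rw [Subtype.range_coe]
    exact Subgroup.subset_closure
  · have hleft : ψ.comp (ConjHNN.toAmbient H t) = MonoidHom.id _ :=
      HNNExtension.hom_ext (MonoidHom.ext fun h => by simp [hψH]) (by simp [hψt])
    exact Function.LeftInverse.injective (g := ψ) (DFunLike.congr_fun hleft)
  · have hcomp : (ConjHNN.toAmbient H t).comp F = q := by
      rw [hq]
      ext s
      simp [F]
    intro g
    obtain ⟨w, rfl⟩ := hq_surj g
    exact ⟨F w, DFunLike.congr_fun hcomp w⟩
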